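/- A non-commutative space $X$ is a Grothendieck category $\mathsf{Mod}\,X$, whose objects are called $X$-modules; $X$ is locally noetherian if $\mathsf{Mod}\,X$ has a set of noetherian generators. A weakly closed subspace $W$ of $X$ is a full subcategory $\mathsf{Mod}\,W\subseteq\mathsf{Mod}\,X$ that is closed under subquotients and whose inclusion functor has a right adjoint; it is closed if the inclusion functor also has a left adjoint. Subspaces are ordered by inclusion of their module categories. The support of a module $M$ is the smallest closed subspace $Z$ with $M\in\mathsf{Mod}\,Z$ (the intersection of all closed subspaces containing $M$). A non-zero module is prime if all its non-zero submodules have the same support. A prime subspace is a closed subspace $Z$ with $\mathsf{Mod}\,Z\neq 0$ that is the support of some noetherian prime module. A locally noetherian space $X$ has enough closed subspaces if, for every noetherian module $M$, the smallest weakly closed subspace containing $M$ equals the support of $M$. A non-zero noetherian module $M$ is critical if $\operatorname{Kdim}(M/N)<\operatorname{Kdim} M$ for every non-zero submodule $N\subseteq M$, where $\operatorname{Kdim}$ is Gabriel's Krull dimension: $\operatorname{Kdim} 0=-1$, and for $M\ne 0$ it is the least ordinal $\alpha$ with $M\in\mathsf{C}_\alpha$, where $\mathsf{C}_{-1}=0$,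 $\mathsf{C}_{\alpha+1}$ is the smallest localizing subcategory containing $\mathsf{C}_{\alpha}$ and all objects whose image in $\mathsf{Mod}\,X/\mathsf{C}_{\alpha}$ is simple, and, for a limit ordinal $\alpha$, $\mathsf{C}_\alpha$ is the smallest localizing subcategory containing all $\mathsf{C}_\beta$ with $\beta<\alpha$. Proposition. Let $X$ be a locally noetherian space that satisfies the descending chain condition on closed subspaces and has enough closed subspaces. Then every prime subspace $Z$ of $X$ is the support of some critical (noetherian) prime module, every such module has an injective envelope, and there is a bijection $$\{\text{prime subspaces of } X\}\longleftrightarrow\{\text{indecomposable injective } X\text{-modules}\}/\cong$$ that sends $Z$ to the isomorphism class of the injective envelope of $M$, for every critical noetherian prime module $M$ with support $Z$ (the class does not depend on the choice of $M$). -/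

import Mathlib

open CategoryTheory CategoryTheory.Limits

universe v u

namespace NCSpace

section Subspaces

variable {C : Type u} [Category.{v} C] [Abelian C]

/-- A weakly closed subspace: a full subcategory closed under subquotients whose inclusion functor
has a right adjoint. -/
structure IsWeaklyClosed (W : ObjectProperty C) : Prop where
  closedUnderSubobjects : W.IsClosedUnderSubobjects
  closedUnderQuotients : W.IsClosedUnderQuotients
  hasRightAdjoint : W.ι.IsLeftAdjoint

/-- A closed subspace: a weakly closed subspace whose inclusion functor also has a left adjoint. -/
structure IsClosedSubspace (Z : ObjectProperty C) : Prop extends IsWeaklyClosed Z where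
  hasLeftAdjoint : Z.ι.IsRightAdjoint

variable (C) in
/-- The closed subspaces, ordered by containment. -/
abbrev ClosedSubspace : Type u :=
  {Z : ObjectProperty C // IsClosedSubspace Z}

/-- The smallest weakly closed subspace containing `M`, as the intersection of all of them. -/
def weakSupport (M : C) : ObjectProperty C :=
  fun N => ∀ W : ObjectProperty C, IsWeaklyClosed W → W M → W N

/-- The support of `M`: the smallest closed subspace containing `M`, as the intersection of all
of them. -/
def support (M : C) : ObjectProperty C :=
  fun N => ∀ Z : ObjectProperty C, IsClosedSubspace Z → Z M → Z N

/-- A prime module: a non-zero module all of whose non-zero submodules have the same support. -/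
def IsPrimeModule (M : C) : Prop :=
  ¬ IsZero M ∧ ∀ (N : C) (i : N ⟶ M) [Mono i], ¬ IsZero N → support N = support M

/-- A prime subspace: a non-empty closed subspace (its module category is not the zero category)
that is the support of a noetherian prime module. -/
structure IsPrimeSubspace (Z : ObjectProperty C) : Prop where
  isClosed : IsClosedSubspace Z
  nonempty : ∃ M : C, Z M ∧ ¬ IsZero M
  exists_prime : ∃ M : C, IsNoetherianObject M ∧ IsPrimeModule M ∧ support M = Z

variable (C) in
/-- The prime subspaces. -/
abbrev PrimeSubspace : Type u :=
  {Z : ObjectProperty C // IsPrimeSubspace Z}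

variable (C) in
/-- There is a small set of noetherian generators. -/
def IsLocallyNoetherian : Prop :=
  ∃ P : ObjectProperty C, ObjectProperty.Small.{v} P ∧ P.IsSeparating ∧ P ≤ isNoetherianObject

variable (C) in
/-- The smallest weakly closed subspace containing a noetherian module is its support. -/
def HasEnoughClosedSubspaces : Prop :=
  ∀ M : C, IsNoetherianObject M → weakSupport M = support M

end Subspaces

section KrullDimension

variable (C : Type u) [Category.{v} C] [Abelian C]

/-- A localizing subcategory of a Grothendieck category: a Serre subcategory closed under
small coproducts. -/
structure LocalizingSubcategory where
  prop : ObjectProperty C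
  isSerreClass : prop.IsSerreClass
  closedUnderCoproducts : ∀ J : Type v, prop.IsClosedUnderColimitsOfShape (Discrete J)

variable {C}

/-- The smallest localizing subcategory containing `P`. -/
def localizingClosure (P : ObjectProperty C) : LocalizingSubcategory C where
  prop := fun M => ∀ L : LocalizingSubcategory C, P ≤ L.prop → L.prop M
  isSerreClass :=
    { exists_zero := by
        obtain ⟨Z, hZ⟩ := HasZeroObject.zero (C := C)
        refine ⟨Z, hZ, fun L _ => ?_⟩
        have := L.isSerreClass
        exact L.prop.prop_of_isZero hZ
      prop_of_mono := fun f _ h L hL => by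
        have := L.isSerreClass
        exact L.prop.prop_of_mono f (h L hL)
      prop_of_epi := fun f _ h L hL => by
        have := L.isSerreClass
        exact L.prop.prop_of_epi f (h L hL)
      prop_X₂_of_shortExact := fun hS h₁ h₃ L hL => by
        have := L.isSerreClass
        exact L.prop.prop_X₂_of_shortExact hS (h₁ L hL) (h₃ L hL) }
  closedUnderCoproducts J :=
    { colimitsOfShape_le := by
        intro M hM L hL
        have := L.closedUnderCoproducts J
        obtain ⟨h⟩ := hM
        exact L.prop.prop_of_isColimit h.isColimit (fun j => h.prop_diag_obj j L hL) }

/-- The objects whose image in the quotient category `C / L` is simple. -/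
def simpleModulo (L : LocalizingSubcategory C) : ObjectProperty C :=
  fun M =>
    haveI := L.isSerreClass
    Simple (L.prop.isoModSerre.Q.obj M)

/-- The smallest localizing subcategory containing `L` and all objects with simple image in
`C / L`. -/
def gabrielStep (L : LocalizingSubcategory C) : LocalizingSubcategory C :=
  localizingClosure (L.prop ⊔ simpleModulo L)

variable (C) in
/-- Gabriel's filtration `C₀ ⊆ C₁ ⊆ ⋯` of `C` by localizing subcategories: `C₋₁` consists of the
zero objects, `C_{α+1}` is obtained from `C_α` by adjoining the objects that are simple modulo
`C_α` (with `α = -1` allowed), and `C_α` is generated by the union of the earlier terms if `α` is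
a limit ordinal. -/
noncomputable def gabrielFiltration (α : Ordinal.{v}) : LocalizingSubcategory C :=
  Ordinal.limitRecOn α
    (gabrielStep (localizingClosure (fun M => IsZero M)))
    (fun _ L => gabrielStep L)
    (fun α _ L => localizingClosure (fun M => ∃ (β : Ordinal.{v}) (h : β < α), (L β h).prop M))

open Classical in
/-- Gabriel's Krull dimension: `-1`, here `⊥`, for zero objects, and otherwise the least `α` with
`M ∈ C_α`. In a locally noetherian category every object lies in some `C_α`. -/
noncomputable def krullDim (M : C) : WithBot Ordinal.{v} :=
  if IsZero M then ⊥ else ((sInf {α | (gabrielFiltration C α).prop M} : Ordinal.{v}) : WithBot _)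

/-- A critical module: a non-zero noetherian module `M` such that `Kdim (M / N) < Kdim M` for all
non-zero submodules `N`. -/
def IsCritical (M : C) : Prop :=
  IsNoetherianObject M ∧ ¬ IsZero M ∧
    ∀ N : Subobject M, N ≠ ⊥ → krullDim (cokernel N.arrow) < krullDim M

end KrullDimension

section Injectives

variable {C : Type u} [Category.{v} C] [Abelian C]

/-- `i` exhibits `E` as an injective envelope of `M`: `E` is injective and `i` is an essential
monomorphism, i.e. every non-zero subobject of `E` meets the image of `M`. -/
structure IsInjectiveEnvelope {M E : C} (i : M ⟶ E) : Prop where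
  injective : Injective E
  mono : Mono i
  essential : ∀ (N : C) (j : N ⟶ E) [Mono j], ¬ IsZero N → ¬ IsZero (pullback i j)

variable (C) in
/-- The isomorphism classes of indecomposable injective objects. -/
abbrev IndecInjective : Type u :=
  {e : Quotient (isIsomorphicSetoid C) //
    ∃ E : C, Quotient.mk (isIsomorphicSetoid C) E = e ∧ Injective E ∧ Indecomposable E}

end Injectives

end NCSpace

/-!
A noetherian module has a critical submodule, and a critical module `M` is uniform, so its injective
envelope is indecomposable. Conversely, every non-zero submodule of an indecomposable injective `E`
is essential in it (`isEssentialMono_of_indecomposable`). A noetherian submodule of `E` with minimal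
support is prime by the descending chain condition (`exists_isPrimeModule_sub`); it contains a
critical submodule with the same support, whose envelope is `E`. Any two prime submodules of `E`
meet, so they have the same support (`support_eq_of_iso`). This attaches a prime subspace to `E`,
and every prime subspace arises.

What remains is that critical modules `M` and `M'` with the same support have isomorphic envelopes
(`nonempty_iso_of_support_eq`). Since there are enough closed subspaces, `M'` lies in every weakly
closed subspace containing `M`. One of these is the class of objects all of whose non-zero
subquotients contain a non-zero subquotient of `M`, an instance of `loewyClass`. Hence some
non-zero submodule of `M'` is a quotient `Y / K` of a submodule `Y` of `M`, and vice versa. So `M`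
and `M'` have the same Krull dimension, and `K = 0` since proper quotients of `Y` have smaller
dimension (`IsCritical.exists_common_sub`). Thus `M` and `M'` share the non-zero submodule `Y`, which
is essential in both envelopes.

The class `loewyClass P` of objects all of whose non-zero subquotients contain a non-zero subobject
in `P` carries most of the argument. It is localizing for every `P`: closure under coproducts
follows from closure under extensions by AB5. Besides the application above, it shows that
a non-zero object of a localizing subcategory generated by a class of objects contains a non-zero
object closely related to that class, which gives the existence of critical submodules
(`exists_isCritical_sub`).
-/

namespace NCSpace

/-! ### Subquotients -/

section Subquotients

variable {C : Type u} [Category.{v} C]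

/-- `Z` is a subquotient of `X`: a quotient of a subobject of `X`. -/
def IsSubquotient (Z X : C) : Prop :=
  ∃ (Y : C) (i : Y ⟶ X) (p : Y ⟶ Z), Mono i ∧ Epi p

lemma IsSubquotient.of_mono {Z X : C} (i : Z ⟶ X) [Mono i] : IsSubquotient Z X :=
  ⟨Z, i, 𝟙 Z, inferInstance, inferInstance⟩

lemma IsSubquotient.of_epi {Z X : C} (p : X ⟶ Z) [Epi p] : IsSubquotient Z X :=
  ⟨X, 𝟙 X, p, inferInstance, inferInstance⟩

lemma IsSubquotient.refl (X : C) : IsSubquotient X X := .of_mono (𝟙 X)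

variable [Abelian C]

lemma IsSubquotient.trans {Z Y X : C} (h₁ : IsSubquotient Z Y) (h₂ : IsSubquotient Y X) :
    IsSubquotient Z X := by
  obtain ⟨A, i, p, _, _⟩ := h₁
  obtain ⟨B, j, q, _, _⟩ := h₂
  exact ⟨pullback i q, pullback.snd i q ≫ j, pullback.fst i q ≫ p, inferInstance, inferInstance⟩

/-- If `a : W ⟶ Y` kills the kernel of `b : W ⟶ X`, then the image of `W` in any quotient of `Y` is
a quotient of the image of `b`. -/
lemma isSubquotient_image {W X Y Z : C} (a : W ⟶ Y) (b : W ⟶ X) (p : Y ⟶ Z)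
    (h : kernel.ι b ≫ a = 0) : IsSubquotient (Abelian.image (a ≫ p)) X := by
  have hb : kernel.ι b ≫ Abelian.factorThruImage (a ≫ p) = 0 := by
    rw [← cancel_mono (Abelian.image.ι (a ≫ p))]
    simp [reassoc_of% h]
  exact ⟨Abelian.coimage b, Abelian.factorThruCoimage b, cokernel.desc _ _ hb, inferInstance,
    epi_of_epi_fac (cokernel.π_desc _ _ hb)⟩

lemma not_isZero_image {X Y : C} {f : X ⟶ Y} (hf : f ≠ 0) : ¬ IsZero (Abelian.image f) := by
  intro h
  apply hf
  rw [← Abelian.image.fac f, h.eq_of_src (Abelian.image.ι f) 0, comp_zero]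

lemma not_isZero_of_mono {X Y : C} (f : X ⟶ Y) [Mono f] (hX : ¬ IsZero X) : ¬ IsZero Y :=
  fun h => hX (IsZero.of_mono f h)

end Subquotients

/-! ### Filtered colimits and generalised elements -/

section FilteredColimits

variable {C : Type u} [Category.{v} C] [Abelian C] [IsGrothendieckAbelian.{v} C]

/-- Axiom AB5 in terms of generalised elements: a filtered colimit `c.pt` of `F` pulls back along
`f : Y ⟶ c.pt` to a jointly epimorphic family on `Y`. -/
lemma exists_comp_ne_zero_of_isColimit {J : Type v} [SmallCategory J] [IsFiltered J]
    {F : J ⥤ C} {c : Cocone F} (hc : IsColimit c) {Y Z : C} (f : Y ⟶ c.pt) (h : Y ⟶ Z)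
    (hh : h ≠ 0) :
    ∃ (j : J) (W : C) (a : W ⟶ Y) (b : W ⟶ F.obj j),
      a ≫ f = b ≫ c.ι.app j ∧ a ≫ h ≠ 0 := by
  by_contra! H
  apply hh
  let β : (Functor.const J).obj Y ⟶ (Functor.const J).obj c.pt := (Functor.const J).map f
  have sq := (IsPullback.of_hasPullback β c.ι).map (colim (J := J) (C := C))
  have : IsConnected J := IsFiltered.isConnected J
  -- `colim.map c.ι` is the canonical isomorphism from `colimit F` to the colimit of the constant
  -- diagram on `c.pt`.
  have hι : IsIso (colim.map c.ι) := by
    let e₁ : colimit F ≅ c.pt := (colimit.isColimit F).coconePointUniqueUpToIso hc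
    let e₂ : c.pt ≅ colimit ((Functor.const J).obj c.pt) :=
      (isColimitConstCocone J c.pt).coconePointUniqueUpToIso (colimit.isColimit _)
    have h₁ (j : J) : colimit.ι F j ≫ e₁.hom = c.ι.app j :=
      (colimit.isColimit F).comp_coconePointUniqueUpToIso_hom hc j
    have h₂ (j : J) : 𝟙 c.pt ≫ e₂.hom = colimit.ι ((Functor.const J).obj c.pt) j :=
      (isColimitConstCocone J c.pt).comp_coconePointUniqueUpToIso_hom (colimit.isColimit _) j
    have e : colim.map c.ι = e₁.hom ≫ e₂.hom := by
      apply colimit.hom_ext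
      intro j
      rw [reassoc_of% (h₁ j), colim_map, ι_colimMap, ← h₂ j, Category.id_comp]
    rw [e]
    infer_instance
  have hfst : IsIso (colim.map (pullback.fst β c.ι)) := sq.isIso_fst_of_isIso
  have hz : colim.map ((Functor.const J).map h) = 0 := by
    rw [← cancel_epi (colim.map (pullback.fst β c.ι)), comp_zero, ← Functor.map_comp]
    apply colimit.hom_ext
    intro j
    have e := NatTrans.congr_app (pullback.condition (f := β) (g := c.ι)) j
    have := H j _ ((pullback.fst β c.ι).app j) ((pullback.snd β c.ι).app j) (by simpa [β] using e)
    simp [this]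
  obtain ⟨j⟩ : Nonempty J := IsFiltered.nonempty
  have h₃ : colimit.ι ((Functor.const J).obj Y) j ≫ colim.map ((Functor.const J).map h) ≫
      colimit.desc ((Functor.const J).obj Z) (constCocone J Z) = h := by
    rw [colim_map, ι_colimMap_assoc, colimit.ι_desc]
    exact Category.comp_id h
  rw [← h₃, hz, zero_comp, comp_zero]
  rfl

end FilteredColimits

/-! ### The localizing subcategory of Loewy objects relative to a class -/

section LoewyClass

variable {C : Type u} [Category.{v} C]

/-- The objects all of whose non-zero subquotients contain a non-zero subobject in `P`. For `P`
the simple objects these are the semi-artinian (Loewy) objects. -/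
def loewyClass (P : ObjectProperty C) : ObjectProperty C :=
  fun X => ∀ Z : C, IsSubquotient Z X → ¬ IsZero Z →
    ∃ (N : C) (k : N ⟶ Z), Mono k ∧ ¬ IsZero N ∧ P N

lemma loewyClass_of_subquotients {P : ObjectProperty C} {X : C}
    (hX : ∀ Z, IsSubquotient Z X → P Z) : loewyClass P X :=
  fun Z hZ h0 => ⟨Z, 𝟙 Z, inferInstance, h0, hX Z hZ⟩

lemma exists_sub_of_loewyClass {P : ObjectProperty C} {X : C} (hX : loewyClass P X)
    (h : ¬ IsZero X) : ∃ (N : C) (k : N ⟶ X), Mono k ∧ ¬ IsZero N ∧ P N :=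
  hX X (.refl X) h

variable [Abelian C]

lemma prop_sigma_of_finite (P : ObjectProperty C) [P.IsSerreClass] {J : Type*} [Finite J]
    (X : J → C) (hX : ∀ j, P (X j)) : P (∐ X) := by
  have : P.IsClosedUnderBinaryProducts := .mk' (by
    rintro _ ⟨F, hF⟩
    have h := P.prop_biprod (hF ⟨.left⟩) (hF ⟨.right⟩)
    exact P.prop_of_iso ((biprod.isoProd _ _).trans
      (HasLimit.isoOfNatIso (diagramIsoPair F)).symm) h)
  have : P.IsClosedUnderFiniteProducts := .mk'
  have := HasFiniteBiproducts.of_hasFiniteProducts (C := C)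
  have e : (∏ᶜ X) ≅ ∐ X := (biproduct.isoProduct X).symm ≪≫ biproduct.isoCoproduct X
  exact P.prop_of_iso e (P.prop_product hX)

lemma loewyClass_of_isSubquotient {P : ObjectProperty C} {X Y : C} (hX : loewyClass P X)
    (h : IsSubquotient Y X) : loewyClass P Y :=
  fun Z hZ => hX Z (hZ.trans h)

/-- For an extension `S` and a subquotient `Z = Y / K` of `S.X₂`, either `Y ∩ S.X₁` has a non-zero
image in `Z`, or `Z` is a subquotient of `S.X₃`. -/
lemma loewyClass_of_shortExact {P : ObjectProperty C} {S : ShortComplex C} (hS : S.ShortExact)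
    (h₁ : loewyClass P S.X₁) (h₃ : loewyClass P S.X₃) : loewyClass P S.X₂ := by
  rintro Z ⟨Y, i, p, _, _⟩ hZ
  have := hS.mono_f
  by_cases h0 : pullback.fst i S.f ≫ p = 0
  · have hk : (kernel.ι (Abelian.factorThruImage (i ≫ S.g)) ≫ i) ≫ S.g = 0 := by
      have h := kernel.condition (Abelian.factorThruImage (i ≫ S.g)) =≫ Abelian.image.ι _
      rwa [Category.assoc, Abelian.image.fac, zero_comp, ← Category.assoc] at h
    have hp : kernel.ι (Abelian.factorThruImage (i ≫ S.g)) ≫ p = 0 := by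
      rw [← pullback.lift_fst (f := i) (g := S.f) (kernel.ι _) (hS.exact.lift _ hk)
        (hS.exact.lift_f _ hk).symm, Category.assoc, h0, comp_zero]
    exact h₃ Z ⟨Abelian.image (i ≫ S.g), Abelian.image.ι _,
      Abelian.epiDesc (Abelian.factorThruImage (i ≫ S.g)) p hp, inferInstance,
      epi_of_epi_fac (Abelian.comp_epiDesc _ p hp)⟩ hZ
  · obtain ⟨N, k, _, hN, hPN⟩ := h₁ (Abelian.image (pullback.fst i S.f ≫ p))
      ⟨pullback i S.f, pullback.snd i S.f, Abelian.factorThruImage _, inferInstance,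
        inferInstance⟩ (not_isZero_image h0)
    exact ⟨N, k ≫ Abelian.image.ι _, inferInstance, hN, hPN⟩

instance (P : ObjectProperty C) : (loewyClass P).IsSerreClass where
  exists_zero := ⟨_, isZero_zero C, fun _ ⟨_, i, p, _, _⟩ hZ =>
    absurd (IsZero.of_epi p (IsZero.of_mono i (isZero_zero C))) hZ⟩
  prop_of_mono f _ h := loewyClass_of_isSubquotient h (.of_mono f)
  prop_of_epi f _ h := loewyClass_of_isSubquotient h (.of_epi f)
  prop_X₂_of_shortExact hS h₁ h₃ := loewyClass_of_shortExact hS h₁ h₃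

variable [IsGrothendieckAbelian.{v} C]

/-- By AB5 a non-zero quotient of a subobject of a coproduct is already non-zero on the part lying
over a finite subcoproduct, which reduces the claim to closure under extensions. -/
lemma loewyClass_sigma (P : ObjectProperty C) {J : Type v} (X : J → C)
    (hX : ∀ j, loewyClass P (X j)) : loewyClass P (∐ X) := by
  classical
  rintro Z ⟨Y, i, p, _, _⟩ hZ
  have hp : p ≠ 0 := fun h => hZ (IsZero.of_epi_eq_zero p h)
  obtain ⟨S, W, a, b, hab, hap⟩ := exists_comp_ne_zero_of_isColimit
    (CoproductsFromFiniteFiltered.isColimitFiniteSubproductsCocone X) i p hp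
  have hS : loewyClass P ((CoproductsFromFiniteFiltered.liftToFinsetObj (Discrete.functor X)).obj S)
    := prop_sigma_of_finite (loewyClass P) (fun s : S => X s.1.as) (fun s => hX _)
  obtain ⟨g, hab⟩ : ∃ g : _ ⟶ ∐ X, a ≫ i = b ≫ g := ⟨_, hab⟩
  have hsub := isSubquotient_image a b p (by
    rw [← cancel_mono i, Category.assoc, hab, kernel.condition_assoc, zero_comp, zero_comp])
  obtain ⟨N, k, _, hN, hPN⟩ := hS _ hsub (not_isZero_image hap)
  exact ⟨N, k ≫ Abelian.image.ι _, inferInstance, hN, hPN⟩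

/-- The class `loewyClass P` as a localizing subcategory. -/
def loewySubcategory (P : ObjectProperty C) : LocalizingSubcategory C where
  prop := loewyClass P
  isSerreClass := inferInstance
  closedUnderCoproducts J :=
    { colimitsOfShape_le := by
        rintro M ⟨h⟩
        have h' := loewyClass_sigma P (fun j => h.diag.obj ⟨j⟩) (fun j => h.prop_diag_obj ⟨j⟩)
        let e : Discrete.functor (fun j => h.diag.obj ⟨j⟩) ≅ h.diag :=
          Discrete.natIso (fun _ => Iso.refl _)
        exact (loewyClass P).prop_of_iso
          ((HasColimit.isoOfNatIso e).trans
            ((colimit.isColimit h.diag).coconePointUniqueUpToIso h.isColimit)) h' }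

end LoewyClass

/-! ### Weakly closed and closed subspaces -/

section ClosedSubspaces

variable {C : Type u} [Category.{v} C]

lemma support_self (M : C) : support M M := fun _ _ h => h

/-- The coprojections factor through the counit at `∐ X`, which is therefore an epimorphism. -/
lemma IsWeaklyClosed.prop_sigma {W : ObjectProperty C} (hW : IsWeaklyClosed W)
    [HasCoproducts.{v} C] (J : Type v) (X : J → C) (hX : ∀ j, W (X j)) : W (∐ X) := by
  have := hW.closedUnderQuotients
  have := hW.hasRightAdjoint
  let adj := Adjunction.ofIsLeftAdjoint W.ι
  let l (j : J) : X j ⟶ W.ι.obj (W.ι.rightAdjoint.obj (∐ X)) :=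
    W.ι.map (adj.homEquiv ⟨X j, hX j⟩ (∐ X) (Sigma.ι X j))
  have hl (j : J) : l j ≫ adj.counit.app (∐ X) = Sigma.ι X j :=
    (adj.homEquiv_counit _ _ _).symm.trans ((adj.homEquiv _ _).symm_apply_apply _)
  have fac : Sigma.desc l ≫ adj.counit.app (∐ X) = 𝟙 _ := by
    apply Sigma.hom_ext
    intro j
    rw [Sigma.ι_desc_assoc, hl, Category.comp_id]
  have : Epi (adj.counit.app (∐ X)) := epi_of_epi_fac fac
  exact W.prop_of_epi (adj.counit.app (∐ X)) (W.ι.rightAdjoint.obj (∐ X)).property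

/-- The projections factor through the unit at `∏ᶜ X`, which is therefore a monomorphism. -/
lemma IsClosedSubspace.prop_pi {Z : ObjectProperty C} (hZ : IsClosedSubspace Z)
    [HasProducts.{v} C] (J : Type v) (X : J → C) (hX : ∀ j, Z (X j)) : Z (∏ᶜ X) := by
  have := hZ.closedUnderSubobjects
  have := hZ.hasLeftAdjoint
  let adj := Adjunction.ofIsRightAdjoint Z.ι
  let l (j : J) : Z.ι.obj (Z.ι.leftAdjoint.obj (∏ᶜ X)) ⟶ X j :=
    Z.ι.map ((adj.homEquiv (∏ᶜ X) ⟨X j, hX j⟩).symm (Pi.π X j))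
  have hl (j : J) : adj.unit.app (∏ᶜ X) ≫ l j = Pi.π X j :=
    (adj.homEquiv_unit _ _ _).symm.trans ((adj.homEquiv _ _).apply_symm_apply _)
  have fac : adj.unit.app (∏ᶜ X) ≫ Pi.lift l = 𝟙 _ := by
    apply Pi.hom_ext
    intro j
    rw [Category.assoc, Pi.lift_π, hl, Category.id_comp]
  have : Mono (adj.unit.app (∏ᶜ X)) := mono_of_mono_fac fac
  exact Z.prop_of_mono (adj.unit.app (∏ᶜ X)) (Z.ι.leftAdjoint.obj (∏ᶜ X)).property

lemma support_le_of_mono {N M : C} (i : N ⟶ M) [Mono i] : support N ≤ support M :=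
  fun _ hX Z hZ hM => hX Z hZ (hZ.closedUnderSubobjects.prop_of_mono i hM)

variable [Abelian C]

/-- The coreflection of `X` is the sum of all subobjects of `X` lying in `W`. -/
lemma isLeftAdjoint_ι (W : ObjectProperty C) [W.IsClosedUnderQuotients]
    [HasCoproducts.{v} C] [WellPowered.{v} C]
    (hW : ∀ (J : Type v) (X : J → C), (∀ j, W (X j)) → W (∐ X)) : W.ι.IsLeftAdjoint := by
  have (X : C) : HasTerminal (CostructuredArrow W.ι X) := by
    let J := Shrink.{v} {K : Subobject X // W (K : C)}
    let K (j : J) : Subobject X := ((equivShrink _).symm j).1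
    let d : (∐ fun j => (K j : C)) ⟶ X := Sigma.desc fun j => (K j).arrow
    have hT : W (Abelian.image d) :=
      W.prop_of_epi (Abelian.factorThruImage d)
        (hW J (fun j => (K j : C)) (fun j => ((equivShrink _).symm j).2))
    let T : CostructuredArrow W.ι X :=
      CostructuredArrow.mk (Y := (⟨_, hT⟩ : W.FullSubcategory)) (Abelian.image.ι d)
    have hex (A : CostructuredArrow W.ι X) : ∃ l : A.left.obj ⟶ Abelian.image d,
        l ≫ Abelian.image.ι d = A.hom := by
      have hA : W (imageSubobject A.hom : C) :=
        W.prop_of_epi (factorThruImageSubobject A.hom) A.left.property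
      let j : J := equivShrink _ ⟨imageSubobject A.hom, hA⟩
      have hj : K j = imageSubobject A.hom := by simp [K, j]
      refine ⟨factorThruImageSubobject A.hom ≫ Subobject.ofLE _ _ hj.ge ≫
        Sigma.ι (fun j => (K j : C)) j ≫ Abelian.factorThruImage d, ?_⟩
      simp [d]
    refine IsTerminal.hasTerminal (X := T) (IsTerminal.ofUniqueHom
      (fun A => CostructuredArrow.homMk (ObjectProperty.homMk (hex A).choose)
        (hex A).choose_spec) ?_)
    intro A m
    apply CostructuredArrow.hom_ext
    apply ObjectProperty.hom_ext
    rw [← cancel_mono (Abelian.image.ι d)]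
    exact (CostructuredArrow.w m).trans (hex A).choose_spec.symm
  exact isLeftAdjoint_of_costructuredArrowTerminals _

/-- The reflection of `X` is the image of `X` in the product of all its quotients lying in `W`. -/
lemma isRightAdjoint_ι (W : ObjectProperty C) [W.IsClosedUnderSubobjects]
    [HasProducts.{v} C] [WellPowered.{v} C]
    (hW : ∀ (J : Type v) (X : J → C), (∀ j, W (X j)) → W (∏ᶜ X)) : W.ι.IsRightAdjoint := by
  have (X : C) : HasInitial (StructuredArrow X W.ι) := by
    let J := Shrink.{v} {K : Subobject X // W (cokernel K.arrow)}
    let K (j : J) : Subobject X := ((equivShrink _).symm j).1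
    let d : X ⟶ ∏ᶜ fun j => cokernel (K j).arrow := Pi.lift fun j => cokernel.π (K j).arrow
    have hT : W (Abelian.image d) :=
      W.prop_of_mono (Abelian.image.ι d)
        (hW J (fun j => cokernel (K j).arrow) (fun j => ((equivShrink _).symm j).2))
    let T : StructuredArrow X W.ι :=
      StructuredArrow.mk (Y := (⟨_, hT⟩ : W.FullSubcategory)) (Abelian.factorThruImage d)
    have hex (A : StructuredArrow X W.ι) : ∃ l : Abelian.image d ⟶ A.right.obj,
        Abelian.factorThruImage d ≫ l = A.hom := by
      have e : cokernel (kernelSubobject A.hom).arrow ≅ Abelian.coimage A.hom :=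
        cokernelIsoOfEq (kernelSubobject_arrow A.hom).symm ≪≫ cokernelEpiComp _ _
      have hA : W (cokernel (kernelSubobject A.hom).arrow) :=
        W.prop_of_mono (e.hom ≫ Abelian.factorThruCoimage A.hom) A.right.property
      let j : J := equivShrink _ ⟨kernelSubobject A.hom, hA⟩
      have hj : K j = kernelSubobject A.hom := by simp [K, j]
      refine ⟨Abelian.image.ι d ≫ Pi.π (fun j => cokernel (K j).arrow) j ≫
        cokernel.desc (K j).arrow A.hom (by rw [hj]; exact kernelSubobject_arrow_comp _), ?_⟩
      rw [← Category.assoc, Abelian.image.fac, Pi.lift_π_assoc, cokernel.π_desc]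
    refine IsInitial.hasInitial (X := T) (IsInitial.ofUniqueHom
      (fun A => StructuredArrow.homMk (ObjectProperty.homMk (hex A).choose)
        (hex A).choose_spec) ?_)
    intro A m
    apply StructuredArrow.hom_ext
    apply ObjectProperty.hom_ext
    rw [← cancel_epi (Abelian.factorThruImage d)]
    exact (StructuredArrow.w m).trans (hex A).choose_spec.symm
  exact isRightAdjointOfStructuredArrowInitials _

variable [IsGrothendieckAbelian.{v} C]

/-- An intersection of closed subspaces is closed, since closedness amounts to closure under
subquotients, coproducts and products. -/
lemma isClosedSubspace_support (M : C) : IsClosedSubspace (support M) where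
  closedUnderSubobjects :=
    ⟨fun f _ h Z hZ hM => hZ.closedUnderSubobjects.prop_of_mono f (h Z hZ hM)⟩
  closedUnderQuotients :=
    ⟨fun f _ h Z hZ hM => hZ.closedUnderQuotients.prop_of_epi f (h Z hZ hM)⟩
  hasRightAdjoint := by
    have : (support M).IsClosedUnderQuotients :=
      ⟨fun f _ h Z hZ hM => hZ.closedUnderQuotients.prop_of_epi f (h Z hZ hM)⟩
    exact isLeftAdjoint_ι _ fun J X h Z hZ hM =>
      hZ.toIsWeaklyClosed.prop_sigma J X (fun j => h j Z hZ hM)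
  hasLeftAdjoint := by
    have : (support M).IsClosedUnderSubobjects :=
      ⟨fun f _ h Z hZ hM => hZ.closedUnderSubobjects.prop_of_mono f (h Z hZ hM)⟩
    exact isRightAdjoint_ι _ fun J X h Z hZ hM => hZ.prop_pi J X (fun j => h j Z hZ hM)

lemma isWeaklyClosed_loewyClass (P : ObjectProperty C) : IsWeaklyClosed (loewyClass P) where
  closedUnderSubobjects := inferInstance
  closedUnderQuotients := inferInstance
  hasRightAdjoint := isLeftAdjoint_ι _ fun _ X h => loewyClass_sigma P X h

end ClosedSubspaces

/-! ### Noetherian objects -/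

section Noetherian

variable {C : Type u} [Category.{v} C] [Abelian C]

lemma subobject_factors_of_epi_comp {W X Y : C} (T : Subobject Y) (e : W ⟶ X) [Epi e] (f : X ⟶ Y)
    (h : T.Factors (e ≫ f)) : T.Factors f := by
  have h0 : f ≫ cokernel.π T.arrow = 0 := by
    rw [← cancel_epi e, ← Category.assoc, ← T.factorThru_arrow _ h, Category.assoc,
      cokernel.condition, comp_zero, comp_zero]
  rw [← Abelian.monoLift_comp T.arrow f h0]
  exact T.factors_comp_arrow _

/-- Pulling back subobjects along an epimorphism is strictly monotone. -/
lemma isNoetherianObject_of_epi {X Y : C} (p : X ⟶ Y) [Epi p] [IsNoetherianObject X] :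
    IsNoetherianObject Y := by
  have hle (S T : Subobject Y) (h : (Subobject.pullback p).obj S ≤ (Subobject.pullback p).obj T) :
      S ≤ T := by
    apply Subobject.le_of_factors
    apply subobject_factors_of_epi_comp T (pullback.snd p S.arrow)
    rw [← pullback.condition, ← pullback_factors_iff]
    refine Subobject.factors_of_le _ h ?_
    rw [pullback_factors_iff, pullback.condition]
    exact S.factors_comp_arrow _
  have hmono : StrictMono (Subobject.pullback p).obj :=
    (Subobject.pullback p).monotone.strictMono_of_injective fun S T h =>
      le_antisymm (hle _ _ h.le) (hle _ _ h.ge)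
  exact ⟨hmono.wellFoundedGT⟩

end Noetherian

/-! ### Simplicity modulo a localizing subcategory -/

section Localizing

variable {C : Type u} [Category.{v} C] [Abelian C]

lemma le_localizingClosure (P : ObjectProperty C) : P ≤ (localizingClosure P).prop :=
  fun _ h _ hL => hL _ h

lemma localizingClosure_le {P : ObjectProperty C} {L : LocalizingSubcategory C}
    (h : P ≤ L.prop) : (localizingClosure P).prop ≤ L.prop :=
  fun _ hM => hM L h

lemma LocalizingSubcategory.prop_of_isSubquotient (L : LocalizingSubcategory C) {Z X : C}
    (h : IsSubquotient Z X) (hX : L.prop X) : L.prop Z := by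
  obtain ⟨Y, i, p, _, _⟩ := h
  exact L.isSerreClass.prop_of_epi p (L.isSerreClass.prop_of_mono i hX)

lemma LocalizingSubcategory.prop_of_mono_of_cokernel (L : LocalizingSubcategory C) {N X : C}
    (i : N ⟶ X) [Mono i] (hN : L.prop N) (hX : L.prop (cokernel i)) : L.prop X :=
  L.isSerreClass.prop_X₂_of_shortExact (S := .mk i (cokernel.π i) (cokernel.condition i))
    { exact := ShortComplex.exact_cokernel i } hN hX

lemma isZero_of_localizingClosure_isZero [IsGrothendieckAbelian.{v} C] {M : C}
    (h : (localizingClosure (IsZero (C := C))).prop M) : IsZero M := by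
  by_contra hM
  have h' := localizingClosure_le (L := loewySubcategory IsZero)
    (fun X hX => loewyClass_of_subquotients fun Z ⟨_, i, p, _, _⟩ =>
      IsZero.of_epi p (IsZero.of_mono i hX)) M h
  obtain ⟨N, k, _, hN, hN'⟩ := exists_sub_of_loewyClass h' hM
  exact hN hN'

/-- An object outside `L` all of whose proper quotients lie in `L` is simple modulo `L`: by the
calculus of fractions, subobjects in `C / L` come from subobjects in `C`. -/
lemma simpleModulo_of_cokernel (L : LocalizingSubcategory C) {M : C} (hM : ¬ L.prop M)
    (h : ∀ (N : C) (i : N ⟶ M) [Mono i], ¬ IsZero N → L.prop (cokernel i)) :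
    simpleModulo L M := by
  have := L.isSerreClass
  let Q := L.prop.isoModSerre.Q
  let := ObjectProperty.SerreClassLocalization.abelian Q L.prop
  have := ObjectProperty.SerreClassLocalization.preservesEpimorphisms Q L.prop
  have := Localization.essSurj Q L.prop.isoModSerre
  change Simple (Q.obj M)
  refine ⟨fun {Y} f _ => ⟨fun hf h0 => ?_, fun hf => ?_⟩⟩
  · subst h0
    apply hM
    rw [← ObjectProperty.SerreClassLocalization.isZero_obj_iff Q L.prop]
    exact IsZero.of_epi_eq_zero (0 : Y ⟶ Q.obj M) rfl
  · obtain ⟨φ, hφ⟩ := Localization.exists_rightFraction Q L.prop.isoModSerre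
      ((Q.objObjPreimageIso Y).hom ≫ f)
    have := Localization.inverts Q L.prop.isoModSerre _ φ.hs
    have e : Q.map φ.s ≫ (Q.objObjPreimageIso Y).hom ≫ f = Q.map φ.f := by
      rw [hφ, MorphismProperty.RightFraction.map_s_comp_map]
    have hne : φ.f ≠ 0 := by
      intro h0
      apply hf
      rw [h0, Q.map_zero] at e
      rw [← cancel_epi (Q.objObjPreimageIso Y).hom, ← cancel_epi (Q.map φ.s), e]
      simp
    have hι := h _ (Abelian.image.ι φ.f) (not_isZero_image hne)
    have : IsIso (Q.map (Abelian.image.ι φ.f)) := by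
      rw [ObjectProperty.SerreClassLocalization.isIso_map_iff Q L.prop,
        ObjectProperty.isoModSerre_iff_of_mono]
      exact hι
    have : Epi (Q.map φ.f) := by
      rw [← Abelian.image.fac φ.f, Q.map_comp]
      infer_instance
    have : Epi f := by
      rw [← Category.assoc] at e
      exact epi_of_epi_fac e
    exact isIso_of_mono_of_epi f

/-- If `M` is simple modulo `L`, then each subobject `Y` of `M` is zero or simple modulo `L`; this is
stated for the subobjects of `Y` in the original category. -/
lemma prop_or_prop_cokernel_of_simpleModulo (L : LocalizingSubcategory C) {M Y N : C}
    (hM : simpleModulo L M) (i : Y ⟶ M) [Mono i] (j : N ⟶ Y) [Mono j] :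
    L.prop N ∨ L.prop (cokernel j) := by
  have := L.isSerreClass
  let Q := L.prop.isoModSerre.Q
  let := ObjectProperty.SerreClassLocalization.abelian Q L.prop
  have := ObjectProperty.SerreClassLocalization.preservesMonomorphisms Q L.prop
  have : Simple (Q.obj M) := hM
  by_cases h0 : Q.map (j ≫ i) = 0
  · left
    rw [← ObjectProperty.SerreClassLocalization.isZero_obj_iff Q L.prop]
    exact IsZero.of_mono_eq_zero _ h0
  · right
    have h1 : IsIso (Q.map (j ≫ i)) := isIso_of_mono_of_nonzero h0
    rw [Q.map_comp] at h1
    have : Epi (Q.map i) := epi_of_epi (Q.map j) _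
    have : IsIso (Q.map i) := isIso_of_mono_of_epi _
    have h2 : IsIso (Q.map j) := IsIso.of_isIso_comp_right _ (Q.map i)
    rw [ObjectProperty.SerreClassLocalization.isIso_map_iff Q L.prop,
      ObjectProperty.isoModSerre_iff_of_mono] at h2
    exact h2

/-- The objects all of whose proper quotients lie in `L`. -/
def almostIn (L : LocalizingSubcategory C) : ObjectProperty C :=
  fun N => ∀ (K : C) (i : K ⟶ N) [Mono i], ¬ IsZero K → L.prop (cokernel i)

lemma almostIn_of_prop (L : LocalizingSubcategory C) {N : C} (h : L.prop N) : almostIn L N :=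
  fun _ i _ _ => L.prop_of_isSubquotient (.of_epi (cokernel.π i)) h

/-- A subquotient of an object that is simple modulo `L` has, unless it contains a non-zero object
of `L`, all its proper quotients in `L`. -/
lemma loewyClass_almostIn_of_simpleModulo (L : LocalizingSubcategory C) {M : C}
    (hM : simpleModulo L M) : loewyClass (almostIn L) M := by
  rintro Z ⟨Y, i, p, _, _⟩ hZ
  by_cases H : ∃ (N : C) (k : N ⟶ Z), Mono k ∧ ¬ IsZero N ∧ L.prop N
  · obtain ⟨N, k, hk, hN, hL⟩ := H
    exact ⟨N, k, hk, hN, almostIn_of_prop L hL⟩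
  · refine ⟨Z, 𝟙 Z, inferInstance, hZ, fun K k _ hK => ?_⟩
    rcases prop_or_prop_cokernel_of_simpleModulo L hM i (pullback.fst p k) with h | h
    · exact absurd ⟨K, k, inferInstance, hK,
        L.prop_of_isSubquotient (.of_epi (pullback.snd p k)) h⟩ H
    · let m : cokernel (pullback.fst p k) ⟶ cokernel k :=
        cokernel.map _ _ (pullback.snd p k) p pullback.condition
      have : Epi m := epi_of_epi_fac (f := cokernel.π _) (h := p ≫ cokernel.π k) (by simp [m])
      exact L.prop_of_isSubquotient (.of_epi m) h

lemma exists_sub_almostIn_of_gabrielStep [IsGrothendieckAbelian.{v} C]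
    (L : LocalizingSubcategory C) {M : C} (hM : (gabrielStep L).prop M) (h0 : ¬ IsZero M) :
    ∃ (N : C) (k : N ⟶ M), Mono k ∧ ¬ IsZero N ∧ almostIn L N := by
  refine exists_sub_of_loewyClass
    (localizingClosure_le (L := loewySubcategory (almostIn L)) ?_ M hM) h0
  rintro X (hX | hX)
  · exact loewyClass_of_subquotients fun Z hZ => almostIn_of_prop L (L.prop_of_isSubquotient hZ hX)
  · exact loewyClass_almostIn_of_simpleModulo L hX

end Localizing

/-! ### The Gabriel filtration -/

section Filtration

variable {C : Type u} [Category.{v} C] [Abelian C]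

lemma gabrielFiltration_zero :
    gabrielFiltration C 0 = gabrielStep (localizingClosure (fun M => IsZero M)) :=
  Ordinal.limitRecOn_zero _ _ _

lemma gabrielFiltration_add_one (α : Ordinal.{v}) :
    gabrielFiltration C (α + 1) = gabrielStep (gabrielFiltration C α) :=
  Ordinal.limitRecOn_add_one _ _ _ _

lemma gabrielFiltration_limit {α : Ordinal.{v}} (h : Order.IsSuccLimit α) :
    gabrielFiltration C α =
      localizingClosure (fun M => ∃ β < α, (gabrielFiltration C β).prop M) := by
  refine (Ordinal.limitRecOn_limit _ _ _ _ h).trans ?_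
  simp only [exists_prop]
  rfl

lemma le_gabrielStep (L : LocalizingSubcategory C) : L.prop ≤ (gabrielStep L).prop :=
  fun _ h => le_localizingClosure _ _ (Or.inl h)

lemma gabrielFiltration_mono {α β : Ordinal.{v}} (h : α ≤ β) :
    (gabrielFiltration C α).prop ≤ (gabrielFiltration C β).prop := by
  induction β using Ordinal.limitRecOn with
  | zero => rw [nonpos_iff_eq_zero.1 h]
  | add_one β ih =>
    rcases h.eq_or_lt with rfl | h
    · exact le_rfl
    · rw [gabrielFiltration_add_one]
      exact (ih (Order.lt_add_one_iff.1 h)).trans (le_gabrielStep _)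
  | limit β hβ ih =>
    rcases h.eq_or_lt with rfl | h
    · exact le_rfl
    · rw [gabrielFiltration_limit hβ]
      exact fun M hM => le_localizingClosure _ _ ⟨α, h, hM⟩

variable [IsGrothendieckAbelian.{v} C]

/-- If the proper quotients of `Y` lie in the filtration, they all lie in one term, as `Y` has only
a small set of subobjects; then `Y` lies in that term or is simple modulo it. -/
lemma exists_gabrielFiltration_of_cokernel {Y : C}
    (h : ∀ (N : C) (i : N ⟶ Y) [Mono i], ¬ IsZero N →
      ∃ α, (gabrielFiltration C α).prop (cokernel i)) :
    ∃ α, (gabrielFiltration C α).prop Y := by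
  have h' (S : {S : Subobject Y // ¬ IsZero (S : C)}) := h _ S.1.arrow S.2
  choose α hα using h'
  -- The supremum is taken over a `v`-small index type, so it is not a junk value.
  let β : Ordinal.{v} := ⨆ s, α ((equivShrink.{v} _).symm s)
  by_cases hY : (gabrielFiltration C β).prop Y
  · exact ⟨β, hY⟩
  · refine ⟨β + 1, ?_⟩
    rw [gabrielFiltration_add_one]
    refine le_localizingClosure _ _ (Or.inr (simpleModulo_of_cokernel _ hY fun N i _ hN => ?_))
    let S : {S : Subobject Y // ¬ IsZero (S : C)} :=
      ⟨Subobject.mk i, fun h0 => hN (h0.of_iso (Subobject.underlyingIso i).symm)⟩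
    have hle : α S ≤ β := by
      have := Ordinal.le_iSup (fun s => α ((equivShrink.{v} _).symm s)) (equivShrink.{v} _ S)
      simpa using this
    have e : cokernel (Subobject.mk i).arrow ≅ cokernel i :=
      cokernelIsoOfEq (Subobject.underlyingIso_hom_comp_eq_mk i).symm ≪≫ cokernelEpiComp _ _
    exact (gabrielFiltration C β).prop_of_isSubquotient (.of_epi e.hom)
      (gabrielFiltration_mono hle _ (hα S))

lemma kernelSubobject_lt_of_comp_cokernel {X Y N : C} (p : X ⟶ Y) [Epi p] (i : N ⟶ Y) [Mono i]
    (hN : ¬ IsZero N) : kernelSubobject p < kernelSubobject (p ≫ cokernel.π i) := by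
  refine lt_of_le_of_ne (kernelSubobject_comp_le p _) fun heq => hN ?_
  have hf : (kernelSubobject p).Factors (pullback.fst p i) := by
    rw [heq]
    apply kernelSubobject_factors
    rw [pullback.condition_assoc, cokernel.condition, comp_zero]
  rw [kernelSubobject_factors_iff, pullback.condition] at hf
  refine IsZero.of_mono_eq_zero i ?_
  rw [← cancel_epi (pullback.snd p i), hf, comp_zero]

/-- Every noetherian object lies in some term of the Gabriel filtration, by noetherian induction
on its quotients. -/
lemma exists_gabrielFiltration (X : C) [IsNoetherianObject X] :
    ∃ α, (gabrielFiltration C α).prop X := by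
  suffices ∀ (K : Subobject X) (Y : C) (p : X ⟶ Y) [Epi p], kernelSubobject p = K →
      ∃ α, (gabrielFiltration C α).prop Y from this _ X (𝟙 X) rfl
  intro K
  induction K using WellFoundedGT.induction with
  | ind K ih =>
    rintro Y p _ rfl
    exact exists_gabrielFiltration_of_cokernel fun N i _ hN =>
      ih _ (kernelSubobject_lt_of_comp_cokernel p i hN) _ (p ≫ cokernel.π i) rfl

end Filtration

/-! ### Krull dimension and critical objects -/

section KrullDimension

variable {C : Type u} [Category.{v} C] [Abelian C]

lemma krullDim_of_isZero {X : C} (h : IsZero X) : krullDim X = ⊥ := if_pos h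

lemma krullDim_le_of_prop {X : C} {α : Ordinal.{v}} (h : (gabrielFiltration C α).prop X) :
    krullDim X ≤ (α : WithBot Ordinal.{v}) := by
  unfold krullDim
  split_ifs
  · exact bot_le
  · exact WithBot.coe_le_coe.2 (csInf_le' h)

variable [IsGrothendieckAbelian.{v} C]

/-- For noetherian objects the infimum defining the Krull dimension is attained. -/
lemma exists_krullDim_eq {X : C} [IsNoetherianObject X] (h : ¬ IsZero X) :
    ∃ α : Ordinal.{v}, krullDim X = α ∧ (gabrielFiltration C α).prop X :=
  ⟨_, if_neg h, csInf_mem (exists_gabrielFiltration X)⟩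

lemma krullDim_le_of_isSubquotient {Z X : C} [IsNoetherianObject X] (h : IsSubquotient Z X) :
    krullDim Z ≤ krullDim X := by
  by_cases hX : IsZero X
  · obtain ⟨Y, i, p, _, _⟩ := h
    rw [krullDim_of_isZero (IsZero.of_epi p (IsZero.of_mono i hX))]
    exact bot_le
  · obtain ⟨α, e, hα⟩ := exists_krullDim_eq hX
    rw [e]
    exact krullDim_le_of_prop ((gabrielFiltration C α).prop_of_isSubquotient h hα)

/-- The criticality condition for arbitrary monomorphisms instead of subobjects. -/
lemma isCritical_iff {M : C} : IsCritical M ↔ IsNoetherianObject M ∧ ¬ IsZero M ∧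
    ∀ (N : C) (i : N ⟶ M) [Mono i], ¬ IsZero N → krullDim (cokernel i) < krullDim M := by
  refine and_congr_right fun hM => and_congr_right fun _ => ⟨fun h N i _ hN => ?_, fun h S hS => ?_⟩
  · have e : cokernel (Subobject.mk i).arrow ≅ cokernel i :=
      cokernelIsoOfEq (Subobject.underlyingIso_hom_comp_eq_mk i).symm ≪≫ cokernelEpiComp _ _
    have : IsNoetherianObject (cokernel (Subobject.mk i).arrow) :=
      isNoetherianObject_of_epi (cokernel.π _)
    refine (krullDim_le_of_isSubquotient (.of_epi e.hom)).trans_lt (h _ fun h0 => hN ?_)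
    exact IsZero.of_mono_eq_zero i (Subobject.mk_eq_bot_iff_zero.1 h0)
  · refine h _ S.arrow fun h0 => hS ?_
    rw [← Subobject.mk_arrow S, Subobject.mk_eq_bot_iff_zero]
    exact h0.eq_of_src _ _

/-- Otherwise `N` and `M / N` would both lie in a term of the filtration before that of `M`. -/
lemma krullDim_eq_of_isCritical {M N : C} (hM : IsCritical M) (i : N ⟶ M) [Mono i]
    (hN : ¬ IsZero N) : krullDim N = krullDim M := by
  obtain ⟨_, hM0, h⟩ := isCritical_iff.1 hM
  have : IsNoetherianObject N := isNoetherianObject_of_mono i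
  refine (krullDim_le_of_isSubquotient (.of_mono i)).antisymm (not_lt.1 fun hlt => ?_)
  obtain ⟨α, hα, hNα⟩ := exists_krullDim_eq hN
  have hc := h N i hN
  have : IsNoetherianObject (cokernel i) := isNoetherianObject_of_epi (cokernel.π i)
  by_cases h0 : IsZero (cokernel i)
  · have : Mono (0 : cokernel i ⟶ N) := ⟨fun _ _ _ => h0.eq_of_tgt _ _⟩
    have hM' := (gabrielFiltration C α).prop_of_mono_of_cokernel i hNα
      ((gabrielFiltration C α).prop_of_isSubquotient (.of_mono (0 : cokernel i ⟶ N)) hNα)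
    exact (krullDim_le_of_prop hM').not_gt (hα ▸ hlt)
  · obtain ⟨β, hβ, hNβ⟩ := exists_krullDim_eq h0
    have hM' := (gabrielFiltration C (max α β)).prop_of_mono_of_cokernel i
      (gabrielFiltration_mono (le_max_left _ _) _ hNα)
      (gabrielFiltration_mono (le_max_right _ _) _ hNβ)
    refine (krullDim_le_of_prop hM').not_gt ?_
    rcases max_choice α β with e | e <;> rw [e]
    · exact hα ▸ hlt
    · exact hβ ▸ hc

lemma IsCritical.of_mono {M N : C} (hM : IsCritical M) (i : N ⟶ M) [Mono i]
    (hN : ¬ IsZero N) : IsCritical N := by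
  obtain ⟨_, _, h⟩ := isCritical_iff.1 hM
  refine isCritical_iff.2 ⟨isNoetherianObject_of_mono i, hN, fun K j _ hK => ?_⟩
  rw [krullDim_eq_of_isCritical hM i hN]
  have : IsNoetherianObject (cokernel (j ≫ i)) := isNoetherianObject_of_epi (cokernel.π _)
  have sq : IsPullback j (𝟙 K) i (j ≫ i) :=
    ⟨⟨by simp⟩, ⟨PullbackCone.IsLimit.mk _ (fun s => s.snd)
      (fun s => by rw [← cancel_mono i, Category.assoc, s.condition]) (fun s => by simp)
      (fun s m _ hm => by simpa using hm)⟩⟩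
  have := Abelian.mono_cokernel_map_of_isPullback sq
  exact (krullDim_le_of_isSubquotient (.of_mono (cokernel.map _ _ _ _ sq.w))).trans_lt
    (h K (j ≫ i) hK)

/-- Critical objects are uniform. -/
lemma IsCritical.not_isZero_pullback {M A B : C} (hM : IsCritical M) (a : A ⟶ M) (b : B ⟶ M)
    [Mono a] [Mono b] (hA : ¬ IsZero A) (hB : ¬ IsZero B) : ¬ IsZero (pullback a b) := by
  intro h0
  obtain ⟨_, _, h⟩ := isCritical_iff.1 hM
  have : IsNoetherianObject (cokernel a) := isNoetherianObject_of_epi (cokernel.π _)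
  have hm : Mono (b ≫ cokernel.π a) := by
    rw [Preadditive.mono_iff_cancel_zero]
    intro W g hg
    have hg' : (g ≫ b) ≫ cokernel.π a = 0 := by rw [Category.assoc, hg]
    rw [← pullback.lift_snd (f := a) (g := b) (Abelian.monoLift a _ hg') g
      (Abelian.monoLift_comp _ _ _), h0.eq_of_tgt (pullback.lift _ _ _) 0, zero_comp]
  have := krullDim_le_of_isSubquotient (.of_mono (b ≫ cokernel.π a))
  rw [krullDim_eq_of_isCritical hM b hB] at this
  exact this.not_gt (h A a hA)

/-- Every non-zero noetherian object `M` has a critical subobject: if `α` is least such that some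
non-zero subobject `N` of `M` lies in the `α`-th term of the Gabriel filtration, then `α` is not a
limit, and a subobject of `N` all of whose proper quotients lie in the preceding term is
critical. -/
lemma exists_isCritical_sub (M : C) [IsNoetherianObject M] (hM : ¬ IsZero M) :
    ∃ (N : C) (i : N ⟶ M), Mono i ∧ IsCritical N := by
  let A : Set Ordinal.{v} := {α | ∃ (N : C) (i : N ⟶ M), Mono i ∧ ¬ IsZero N ∧
    (gabrielFiltration C α).prop N}
  have hA : A.Nonempty := by
    obtain ⟨α, hα⟩ := exists_gabrielFiltration M
    exact ⟨α, M, 𝟙 M, inferInstance, hM, hα⟩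
  obtain ⟨N, i, _, hN, hNα⟩ := csInf_mem hA
  have hmin (K : C) (j : K ⟶ M) [Mono j] (hK : ¬ IsZero K) :
      (sInf A : Ordinal.{v}) ≤ krullDim K := by
    have : IsNoetherianObject K := isNoetherianObject_of_mono j
    obtain ⟨β, e, hβ⟩ := exists_krullDim_eq hK
    rw [e, WithBot.coe_le_coe]
    exact csInf_le' ⟨K, j, inferInstance, hK, hβ⟩
  generalize hα : sInf A = α at *
  induction α using Ordinal.limitRecOn with
  | zero =>
    rw [gabrielFiltration_zero] at hNα
    obtain ⟨K, k, _, hK, hKL⟩ := exists_sub_almostIn_of_gabrielStep _ hNα hN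
    have : IsNoetherianObject K := isNoetherianObject_of_mono (k ≫ i)
    refine ⟨K, k ≫ i, inferInstance, isCritical_iff.2 ⟨inferInstance, hK, fun T t _ hT => ?_⟩⟩
    rw [krullDim_of_isZero (isZero_of_localizingClosure_isZero (hKL T t hT))]
    obtain ⟨β, e, -⟩ := exists_krullDim_eq hK
    rw [e]
    exact WithBot.bot_lt_coe β
  | add_one α _ =>
    rw [gabrielFiltration_add_one] at hNα
    obtain ⟨K, k, _, hK, hKL⟩ := exists_sub_almostIn_of_gabrielStep _ hNα hN
    have : IsNoetherianObject K := isNoetherianObject_of_mono (k ≫ i)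
    refine ⟨K, k ≫ i, inferInstance, isCritical_iff.2 ⟨inferInstance, hK, fun T t _ hT => ?_⟩⟩
    refine (krullDim_le_of_prop (hKL T t hT)).trans_lt (lt_of_lt_of_le ?_ (hmin K (k ≫ i) hK))
    exact WithBot.coe_lt_coe.2 (Order.lt_add_one_iff.2 le_rfl)
  | limit α hlim _ =>
    rw [gabrielFiltration_limit hlim] at hNα
    obtain ⟨K, k, _, hK, β, hβ, hKβ⟩ := exists_sub_of_loewyClass
      (localizingClosure_le (L := loewySubcategory
        (fun M => ∃ β < α, (gabrielFiltration C β).prop M)) (fun X ⟨β, hβ, hX⟩ =>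
          loewyClass_of_subquotients fun Z hZ =>
            ⟨β, hβ, (gabrielFiltration C β).prop_of_isSubquotient hZ hX⟩) N hNα) hN
    exact absurd (csInf_le' (s := A) ⟨K, k ≫ i, inferInstance, hK, hKβ⟩)
      (by rw [hα]; exact hβ.not_ge)

/-- Two critical objects, each of which meets the subquotients of the other, have a common non-zero
subobject: both have the same Krull dimension, so the subquotient cannot be a proper quotient. -/
lemma IsCritical.exists_common_sub {M M' : C} (hM : IsCritical M) (hM' : IsCritical M')
    (h : loewyClass (IsSubquotient · M) M') (h' : loewyClass (IsSubquotient · M') M) :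
    ∃ (N : C) (i : N ⟶ M) (i' : N ⟶ M'), Mono i ∧ Mono i' ∧ ¬ IsZero N := by
  have hle {M M' : C} (hM : IsCritical M) (hM' : IsCritical M')
      (h : loewyClass (IsSubquotient · M) M') : krullDim M' ≤ krullDim M := by
    obtain ⟨N, k, _, hN, hNM⟩ := exists_sub_of_loewyClass h hM'.2.1
    have := hM.1
    rw [← krullDim_eq_of_isCritical hM' k hN]
    exact krullDim_le_of_isSubquotient hNM
  have heq := (hle hM hM' h).antisymm (hle hM' hM h')
  obtain ⟨N, k, _, hN, Y, i, p, _, _⟩ := exists_sub_of_loewyClass h hM'.2.1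
  have hY : ¬ IsZero Y := fun hY => hN (IsZero.of_epi p hY)
  have hYc := hM.of_mono i hY
  have hp : Mono p := by
    rw [Preadditive.mono_iff_isZero_kernel]
    by_contra hK
    obtain ⟨_, _, hc⟩ := isCritical_iff.1 hYc
    have h1 := hc _ (kernel.ι p) hK
    have : IsNoetherianObject (cokernel (kernel.ι p)) := isNoetherianObject_of_epi (cokernel.π _)
    have h2 : krullDim N ≤ krullDim (cokernel (kernel.ι p)) :=
      krullDim_le_of_isSubquotient (.of_epi (cokernel.desc (kernel.ι p) p (kernel.condition p)))
    rw [krullDim_eq_of_isCritical hM' k hN] at h2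
    rw [krullDim_eq_of_isCritical hM i hY, ← heq] at h1
    exact h2.not_gt h1
  exact ⟨Y, i, p ≫ k, inferInstance, inferInstance, hY⟩

end KrullDimension

/-! ### Essential monomorphisms -/

section Essential

variable {C : Type u} [Category.{v} C] [Abelian C]

/-- `i` is an essential monomorphism, in terms of generalised elements: every non-zero element `h`
of `E` has a non-zero multiple `w ≫ h` in `M`. -/
structure IsEssentialMono {M E : C} (i : M ⟶ E) : Prop where
  mono : Mono i
  exists_comp {T : C} (h : T ⟶ E) (hh : h ≠ 0) :
    ∃ (W : C) (w : W ⟶ T) (e : W ⟶ M), w ≫ h = e ≫ i ∧ w ≫ h ≠ 0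

lemma IsEssentialMono.mono_of_mono_comp {M E Z : C} {i : M ⟶ E} (hi : IsEssentialMono i)
    (g : E ⟶ Z) [Mono (i ≫ g)] : Mono g := by
  rw [Preadditive.mono_iff_cancel_zero]
  intro T h hg
  by_contra hh
  obtain ⟨W, w, e, he, hne⟩ := hi.exists_comp h hh
  have h0 : e = 0 := by
    rw [← cancel_mono (i ≫ g), ← Category.assoc, ← he, Category.assoc, hg, comp_zero, zero_comp]
  exact hne (by rw [he, h0, zero_comp])

lemma IsEssentialMono.not_isZero_pullback {M E N : C} {i : M ⟶ E} (hi : IsEssentialMono i)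
    (j : N ⟶ E) [Mono j] (hN : ¬ IsZero N) : ¬ IsZero (pullback i j) := by
  intro h0
  obtain ⟨W, w, e, he, hne⟩ := hi.exists_comp j (fun h => hN (IsZero.of_mono_eq_zero j h))
  apply hne
  rw [he, ← pullback.lift_fst (f := i) (g := j) e w he.symm, h0.eq_of_tgt (pullback.lift _ _ _) 0,
    zero_comp, zero_comp]

lemma IsInjectiveEnvelope.isEssentialMono {M E : C} {i : M ⟶ E} (hi : IsInjectiveEnvelope i) :
    IsEssentialMono i where
  mono := hi.mono
  exists_comp {T} h hh := by
    have := hi.mono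
    have hP := hi.essential _ (Abelian.image.ι h) (not_isZero_image hh)
    refine ⟨pullback (pullback.snd i (Abelian.image.ι h)) (Abelian.factorThruImage h),
      pullback.snd _ _, pullback.fst _ _ ≫ pullback.fst _ _, ?_, fun h0 => hP ?_⟩
    · rw [Category.assoc, pullback.condition (f := i), pullback.condition_assoc,
        Abelian.image.fac]
    · replace h0 : pullback.snd (pullback.snd i (Abelian.image.ι h)) (Abelian.factorThruImage h) ≫
          Abelian.factorThruImage h ≫ Abelian.image.ι h = 0 := by rwa [Abelian.image.fac]
      rw [← pullback.condition_assoc] at h0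
      refine IsZero.of_mono_eq_zero (pullback.snd i (Abelian.image.ι h)) ?_
      rw [← cancel_epi (pullback.fst (pullback.snd i (Abelian.image.ι h))
        (Abelian.factorThruImage h)), ← cancel_mono (Abelian.image.ι h)]
      simpa using h0

lemma IsEssentialMono.isInjectiveEnvelope {M E : C} {i : M ⟶ E} [hE : Injective E]
    (hi : IsEssentialMono i) : IsInjectiveEnvelope i :=
  ⟨hE, hi.mono, fun _ j _ hN => hi.not_isZero_pullback j hN⟩

lemma IsEssentialMono.exists_mono_extension {M E F : C} {i : M ⟶ E} (hi : IsEssentialMono i)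
    (k : M ⟶ F) [Mono k] [Injective F] : ∃ f : E ⟶ F, Mono f ∧ i ≫ f = k := by
  have := hi.mono
  have : Mono (i ≫ Injective.factorThru k i) := by rw [Injective.comp_factorThru]; infer_instance
  exact ⟨Injective.factorThru k i, hi.mono_of_mono_comp _, Injective.comp_factorThru k i⟩

lemma IsEssentialMono.exists_iso {M E F : C} {i : M ⟶ E} {k : M ⟶ F} (hi : IsEssentialMono i)
    (hk : IsEssentialMono k) [Injective E] [Injective F] : Nonempty (E ≅ F) := by
  have := hk.mono
  have := hi.mono
  obtain ⟨f, _, hf⟩ := hi.exists_mono_extension k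
  have hr : f ≫ Injective.factorThru (𝟙 E) f = 𝟙 E := Injective.comp_factorThru _ _
  have : Mono (k ≫ Injective.factorThru (𝟙 E) f) := by
    rw [← hf, Category.assoc, hr, Category.comp_id]; infer_instance
  have := hk.mono_of_mono_comp (Injective.factorThru (𝟙 E) f)
  refine ⟨⟨f, _, hr, ?_⟩⟩
  rw [← cancel_mono (Injective.factorThru (𝟙 E) f), Category.assoc, hr]
  simp

lemma mono_of_indecomposable_of_split {X Y : C} (hX : Indecomposable X) {f : Y ⟶ X} {r : X ⟶ Y}
    (h : f ≫ r = 𝟙 Y) (hY : ¬ IsZero Y) : Mono r := by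
  have : IsSplitEpi r := ⟨⟨⟨f, h⟩⟩⟩
  rw [Preadditive.mono_iff_isZero_kernel]
  have e := biprod.uniqueUpToIso _ _ (isBilimitBinaryBiconeOfIsSplitEpiOfKernel (f := r)
    (kernelIsKernel r))
  exact (hX.2 _ _ e).resolve_right hY

end Essential

/-! ### Existence of injective envelopes -/

section Envelopes

variable {C : Type u} [Category.{v} C] [Abelian C] [IsGrothendieckAbelian.{v} C]

attribute [local instance] has_smallest_coproducts_of_hasCoproducts in
/-- Upper continuity of the lattice of subobjects: a non-zero generalised element of the union of a
chain has a non-zero multiple in a member of the chain. -/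
lemma exists_factors_of_factors_sSup {X T : C} {c : Set (Subobject X)} (hc : IsChain (· ≤ ·) c)
    (hne : c.Nonempty) (a : T ⟶ X) (ha : a ≠ 0) (hs : (sSup c).Factors a) :
    ∃ d ∈ c, ∃ (W : C) (w : W ⟶ T), w ≫ a ≠ 0 ∧ d.Factors (w ≫ a) := by
  obtain ⟨J, ⟨e⟩⟩ := (inferInstance : Small.{v} c).equiv_small
  let D (j : J) : Subobject X := (e.symm j).1
  let : Preorder J := Preorder.lift D
  have hD : Monotone D := fun _ _ h => h
  have : Nonempty J := ⟨e ⟨_, hne.some_mem⟩⟩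
  have : IsDirectedOrder J := ⟨fun j k => by
    rcases hc.total (e.symm j).2 (e.symm k).2 with h | h
    · exact ⟨k, h, le_refl (D k)⟩
    · exact ⟨j, le_refl (D j), h⟩⟩
  let F : J ⥤ MonoOver X :=
    { obj j := Subobject.representative.obj (D j)
      map h := Subobject.representative.map (homOfLE (hD (leOfHom h)))
      map_id _ := Subsingleton.elim _ _
      map_comp _ _ := Subsingleton.elim _ _ }
  let G : J ⥤ C := F ⋙ MonoOver.forget _ ⋙ Over.forget _
  let f : colimit G ⟶ X := colimit.desc G
    (Cocone.mk X
      { app j := (D j).arrow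
        naturality j k g := (Over.w (F.map g).hom).trans (Category.comp_id _).symm })
  have hf (j : J) : colimit.ι G j ≫ f = (F.obj j).obj.hom := colimit.ι_desc _ _
  have := IsGrothendieckAbelian.mono_of_isColimit_monoOver F (colimit.isColimit G) f hf
  have hmk := IsGrothendieckAbelian.subobjectMk_of_isColimit_eq_iSup F (colimit.isColimit G) f hf
  have hle : sSup c ≤ Subobject.mk f := by
    rw [hmk]
    refine sSup_le fun d hd => ?_
    refine le_trans (le_of_eq ?_) (le_iSup _ (e ⟨d, hd⟩))
    exact (Subobject.mk_arrow d).symm.trans (by simp [F, D])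
  obtain ⟨a', rfl⟩ : ∃ a' : T ⟶ colimit G, a' ≫ f = a :=
    (Subobject.mk_factors_iff f a).1 (Subobject.factors_of_le a hle hs)
  obtain ⟨j, W, w, b, hw, hne⟩ :=
    exists_comp_ne_zero_of_isColimit (colimit.isColimit G) a' (a' ≫ f) ha
  refine ⟨D j, (e.symm j).2, W, w, hne, ?_⟩
  rw [← Category.assoc, show w ≫ a' = b ≫ colimit.ι G j from hw, Category.assoc, hf]
  exact (D j).factors_comp_arrow b

/-- Every object has an injective envelope. Inside an injective object, it is a maximal essential
extension `E` of `M`; with `K` maximal such that `K ⊓ E = ⊥`, the quotient by `K` is an essential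
extension of `E` that embeds over `E`, so it equals `E` and `E` is a direct summand. -/
theorem exists_isEssentialMono_injective (M : C) :
    ∃ (E : C) (i : M ⟶ E), Injective E ∧ IsEssentialMono i := by
  let I := Injective.under M
  let ι : M ⟶ I := Injective.ι M
  let s : Set (Subobject I) := {E | Subobject.mk ι ≤ E ∧ ∀ (T : C) (a : T ⟶ I), E.Factors a →
    a ≠ 0 → ∃ (W : C) (w : W ⟶ T), w ≫ a ≠ 0 ∧ (Subobject.mk ι).Factors (w ≫ a)}
  have hs : Subobject.mk ι ∈ s := ⟨le_rfl, fun T a ha h0 => ⟨T, 𝟙 T, by simpa, by simpa⟩⟩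
  obtain ⟨E, -, ⟨hME, hE⟩, hmax⟩ := zorn_le_nonempty₀ s (fun c hcs hc y hy => by
    refine ⟨sSup c, ⟨(hcs hy).1.trans (le_sSup hy), fun T a ha h0 => ?_⟩, fun z hz => le_sSup hz⟩
    obtain ⟨d, hd, W, w, hw0, hw⟩ := exists_factors_of_factors_sSup hc ⟨y, hy⟩ a h0 ha
    obtain ⟨W', w', h0', hw'⟩ := (hcs hd).2 _ _ hw hw0
    exact ⟨W', w' ≫ w, by simpa using h0', by simpa using hw'⟩) _ hs
  let t : Set (Subobject I) := {K | ∀ (T : C) (a : T ⟶ I), K.Factors a → E.Factors a → a = 0}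
  obtain ⟨K, -, hK, hKmax⟩ := zorn_le_nonempty₀ t (fun c hct hc y hy => by
    refine ⟨sSup c, fun T a ha hE => ?_, fun z hz => le_sSup hz⟩
    by_contra h0
    obtain ⟨d, hd, W, w, hw0, hw⟩ := exists_factors_of_factors_sSup hc ⟨y, hy⟩ a h0 ha
    exact hw0 (hct hd _ _ hw (E.factors_of_factors_right w hE))) ⊥
      (fun T a ha _ => (Subobject.bot_factors_iff_zero a).1 ha)
  let π : I ⟶ cokernel K.arrow := cokernel.π K.arrow
  have hπ {W : C} (g : W ⟶ I) : g ≫ π = 0 ↔ K.Factors g := by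
    refine ⟨fun h => ?_, fun h => ?_⟩
    · rw [← Abelian.monoLift_comp K.arrow g h]
      exact K.factors_comp_arrow _
    · rw [← K.factorThru_arrow g h, Category.assoc, cokernel.condition, comp_zero]
  have hqm : Mono (E.arrow ≫ π) := by
    rw [Preadditive.mono_iff_cancel_zero]
    intro W g hg
    rw [← Category.assoc, hπ] at hg
    rw [← cancel_mono E.arrow, zero_comp]
    exact hK _ _ hg (E.factors_comp_arrow g)
  have hq : IsEssentialMono (E.arrow ≫ π) := by
    refine ⟨hqm, fun {T} h hh => ?_⟩
    -- The preimage `L` of the image of `h` strictly contains `K`, so it meets `E`.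
    let L : Subobject I := kernelSubobject (π ≫ cokernel.π h)
    have hL {W : C} (g : W ⟶ I) : L.Factors g ↔ g ≫ π ≫ cokernel.π h = 0 :=
      kernelSubobject_factors_iff _ _
    have hKL : K ≤ L := Subobject.le_of_factors ((hL _).2 (by simp [π]))
    have hLt : L ∉ t := fun hLt => by
      have hLK := hKmax hLt hKL
      apply hh
      have h0 := Subobject.factors_of_le (pullback.snd h π) hLK
        ((hL _).2 (by rw [← pullback.condition_assoc, cokernel.condition, comp_zero]))
      rw [← hπ, ← pullback.condition] at h0
      rw [← cancel_epi (pullback.fst h π), h0, comp_zero]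
    simp only [t, Set.mem_ofPred_eq, not_forall] at hLt
    obtain ⟨A, a, haL, haE, ha⟩ := hLt
    obtain ⟨a', rfl⟩ : ∃ a', a' ≫ E.arrow = a := ⟨_, E.factorThru_arrow a haE⟩
    have haL' : (a' ≫ E.arrow ≫ π) ≫ cokernel.π h = 0 := by simpa using (hL _).1 haL
    obtain ⟨l, hl⟩ : ∃ l : A ⟶ Abelian.image h, l ≫ Abelian.image.ι h = a' ≫ E.arrow ≫ π :=
      ⟨kernel.lift (cokernel.π h) _ haL', kernel.lift_ι _ _ _⟩
    have hw : pullback.snd l (Abelian.factorThruImage h) ≫ h =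
        (pullback.fst l (Abelian.factorThruImage h) ≫ a') ≫ E.arrow ≫ π := by
      rw [Category.assoc, ← hl, pullback.condition_assoc, Abelian.image.fac]
    refine ⟨_, _, _, hw, fun h0 => ha ?_⟩
    have h1 : a' = 0 := by
      rw [← cancel_epi (pullback.fst l (Abelian.factorThruImage h)),
        ← cancel_mono (E.arrow ≫ π), ← hw, h0, comp_zero, zero_comp]
    rw [h1, zero_comp]
  -- The extension `φ` identifies `I / K` with an essential extension of `M` in `I` containing `E`.
  obtain ⟨φ, _, hφ⟩ := hq.exists_mono_extension E.arrow
  have hEφ : E ≤ Subobject.mk φ := Subobject.le_of_factors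
    ((Subobject.mk_factors_iff _ _).2 ⟨E.arrow ≫ π, hφ⟩)
  have hφs : Subobject.mk φ ∈ s := by
    refine ⟨hME.trans hEφ, fun T a ha h0 => ?_⟩
    obtain ⟨a', rfl⟩ : ∃ a', a' ≫ φ = a := (Subobject.mk_factors_iff _ _).1 ha
    obtain ⟨W, w, e, he, hne⟩ := hq.exists_comp a' (fun h => h0 (by rw [h, zero_comp]))
    have hwE : w ≫ a' ≫ φ = e ≫ E.arrow := by rw [← hφ, ← Category.assoc, he, Category.assoc]
    obtain ⟨W', w', hne', hf⟩ := hE W (w ≫ a' ≫ φ) (by rw [hwE]; exact E.factors_comp_arrow e)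
      (fun h => hne (by rw [← cancel_mono φ, Category.assoc, h, zero_comp]))
    exact ⟨W', w' ≫ w, by simpa using hne', by simpa using hf⟩
  have hle : Subobject.mk φ ≤ E := hmax hφs hEφ
  obtain ⟨r, hr⟩ : ∃ r, r ≫ E.arrow = φ :=
    ⟨_, E.factorThru_arrow φ (Subobject.factors_of_le φ hle (Subobject.mk_factors_self φ))⟩
  have hret : Retract (E : C) I :=
    { i := E.arrow
      r := π ≫ r
      retract := by
        rw [← cancel_mono E.arrow, Category.assoc, Category.assoc, hr, ← Category.assoc, hφ,
          Category.id_comp] }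
  obtain ⟨i, hi⟩ : ∃ i, i ≫ E.arrow = ι :=
    ⟨_, E.factorThru_arrow ι (Subobject.factors_of_le ι hME (Subobject.mk_factors_self ι))⟩
  have : Mono i := mono_of_mono_fac hi
  refine ⟨E, i, hret.injective, inferInstance, fun {T} h hh => ?_⟩
  obtain ⟨W, w, hne, hf⟩ := hE T (h ≫ E.arrow) (E.factors_comp_arrow h)
    (fun h0 => hh (by rw [← cancel_mono E.arrow, h0, zero_comp]))
  obtain ⟨e, he⟩ : ∃ e, e ≫ ι = w ≫ h ≫ E.arrow := (Subobject.mk_factors_iff ι _).1 hf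
  refine ⟨W, w, e, ?_, fun h0 => hne (by rw [← Category.assoc, h0, zero_comp])⟩
  rw [← cancel_mono E.arrow, Category.assoc, Category.assoc, hi, he]

/-- A non-zero subobject of an indecomposable injective is essential in it: its injective envelope
embeds as a direct summand. -/
lemma isEssentialMono_of_indecomposable {E N : C} [Injective E] (hE : Indecomposable E)
    (j : N ⟶ E) [Mono j] (hN : ¬ IsZero N) : IsEssentialMono j := by
  obtain ⟨F, i, _, hi⟩ := exists_isEssentialMono_injective N
  have := hi.mono
  obtain ⟨f, _, rfl⟩ := hi.exists_mono_extension j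
  have hr : f ≫ Injective.factorThru (𝟙 F) f = 𝟙 F := Injective.comp_factorThru _ _
  have := mono_of_indecomposable_of_split hE hr (not_isZero_of_mono i hN)
  have hr' : Injective.factorThru (𝟙 F) f ≫ f = 𝟙 E := by
    rw [← cancel_mono (Injective.factorThru (𝟙 F) f), Category.assoc, hr]; simp
  refine ⟨inferInstance, fun {T} h hh => ?_⟩
  obtain ⟨W, w, e, he, hne⟩ := hi.exists_comp (h ≫ Injective.factorThru (𝟙 F) f)
    (fun h0 => hh (by rw [← cancel_mono (Injective.factorThru (𝟙 F) f), h0, zero_comp]))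
  have hw : w ≫ h = e ≫ i ≫ f := by
    rw [← Category.assoc e, ← he, Category.assoc, Category.assoc, hr', Category.comp_id]
  exact ⟨W, w, e, hw, fun h0 => hne (by rw [← Category.assoc, h0, zero_comp])⟩

/-- An essential extension of a uniform object is indecomposable. -/
lemma IsEssentialMono.indecomposable {M E : C} {i : M ⟶ E} (hi : IsEssentialMono i)
    (hM : ¬ IsZero M) (hu : ∀ (A B : C) (a : A ⟶ M) (b : B ⟶ M) [Mono a] [Mono b],
      ¬ IsZero A → ¬ IsZero B → ¬ IsZero (pullback a b)) : Indecomposable E := by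
  have := hi.mono
  refine ⟨not_isZero_of_mono i hM, fun Y Z e => ?_⟩
  by_contra! H
  let y : Y ⟶ E := biprod.inl ≫ e.inv
  let z : Z ⟶ E := biprod.inr ≫ e.inv
  refine hu _ _ (pullback.fst i y) (pullback.fst i z) (hi.not_isZero_pullback y H.1)
    (hi.not_isZero_pullback z H.2) ?_
  let p := pullback.fst (pullback.fst i y) (pullback.fst i z)
  let q := pullback.snd (pullback.fst i y) (pullback.fst i z)
  have h1 : (p ≫ pullback.snd i y) ≫ y = (q ≫ pullback.snd i z) ≫ z := by
    rw [Category.assoc, Category.assoc, ← pullback.condition, ← pullback.condition,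
      pullback.condition_assoc]
  have h2 : p ≫ pullback.snd i y = 0 := by
    have := h1 =≫ (e.hom ≫ biprod.fst)
    simpa [y, z] using this
  exact IsZero.of_mono_eq_zero (p ≫ pullback.snd i y) h2

end Envelopes

/-! ### Prime modules and their supports -/

section PrimeModules

variable {C : Type u} [Category.{v} C]

lemma IsPrimeModule.of_mono {M N : C} (hM : IsPrimeModule M) (i : N ⟶ M) [Mono i]
    (hN : ¬ IsZero N) : IsPrimeModule N :=
  ⟨hN, fun K j _ hK => (hM.2 K (j ≫ i) hK).trans (hM.2 N i hN).symm⟩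

variable [Abelian C]

lemma exists_isNoetherianObject_sub (h : IsLocallyNoetherian C) {X : C} (hX : ¬ IsZero X) :
    ∃ (N : C) (i : N ⟶ X), Mono i ∧ IsNoetherianObject N ∧ ¬ IsZero N := by
  obtain ⟨P, -, hsep, hP⟩ := h
  by_contra! H
  refine hX ((IsZero.iff_id_eq_zero X).2 (hsep _ _ fun G hG g => ?_))
  by_contra hg
  have : IsNoetherianObject G := ⟨hP _ hG⟩
  have hg0 : g ≠ 0 := fun h0 => hg (by simp [h0])
  exact not_isZero_image hg0 (H _ (Abelian.image.ι g) inferInstance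
    (isNoetherianObject_of_epi (Abelian.factorThruImage g)))

variable [IsGrothendieckAbelian.{v} C]

/-- Under the descending chain condition a non-zero noetherian subobject with minimal support is
prime. -/
lemma exists_isPrimeModule_sub (h : IsLocallyNoetherian C)
    (hdcc : WellFoundedLT (ClosedSubspace C)) {X : C} (hX : ¬ IsZero X) :
    ∃ (N : C) (i : N ⟶ X), Mono i ∧ IsNoetherianObject N ∧ IsPrimeModule N := by
  let A : Set (ClosedSubspace C) := {Z | ∃ (N : C) (i : N ⟶ X), Mono i ∧ IsNoetherianObject N ∧
    ¬ IsZero N ∧ support N = Z.1}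
  have hA : A.Nonempty := by
    obtain ⟨N, i, hi, hN, h0⟩ := exists_isNoetherianObject_sub h hX
    exact ⟨⟨_, isClosedSubspace_support N⟩, N, i, hi, hN, h0, rfl⟩
  obtain ⟨Z, ⟨N, i, _, _, h0, hZ⟩, hmin⟩ := hdcc.wf.has_min A hA
  refine ⟨N, i, inferInstance, inferInstance, h0, fun K j _ hK => ?_⟩
  have hle := support_le_of_mono j
  refine hle.eq_of_not_lt fun hlt => hmin ⟨_, isClosedSubspace_support K⟩
    ⟨K, j ≫ i, inferInstance, isNoetherianObject_of_mono j, hK, rfl⟩ ?_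
  rw [hZ] at hlt
  exact hlt

lemma exists_isCritical_isPrimeModule_sub {M : C} [IsNoetherianObject M] (hM : IsPrimeModule M) :
    ∃ (N : C) (i : N ⟶ M), Mono i ∧ IsCritical N ∧ IsPrimeModule N ∧ support N = support M := by
  obtain ⟨N, i, _, hN⟩ := exists_isCritical_sub M hM.1
  exact ⟨N, i, inferInstance, hN, hM.of_mono i hN.2.1, hM.2 N i hN.2.1⟩

lemma IsCritical.indecomposable_of_isEssentialMono {M E : C} (hM : IsCritical M) {i : M ⟶ E}
    (hi : IsEssentialMono i) : Indecomposable E :=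
  hi.indecomposable hM.2.1 fun _ _ a b _ _ hA hB => hM.not_isZero_pullback a b hA hB

/-- If there are enough closed subspaces, an object in the support of the noetherian object `M` is
built from subquotients of `M`. -/
lemma support_le_loewyClass (henough : HasEnoughClosedSubspaces C) (M : C)
    [IsNoetherianObject M] : support M ≤ loewyClass (IsSubquotient · M) := by
  rw [← henough M inferInstance]
  exact fun N hN => hN _ (isWeaklyClosed_loewyClass _) (loewyClass_of_subquotients fun _ hZ => hZ)

/-- Critical modules with the same support have isomorphic injective envelopes. -/
lemma nonempty_iso_of_support_eq (henough : HasEnoughClosedSubspaces C) {M M' E E' : C}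
    (hM : IsCritical M) (hM' : IsCritical M') (hs : support M = support M')
    {i : M ⟶ E} {i' : M' ⟶ E'} (hi : IsInjectiveEnvelope i) (hi' : IsInjectiveEnvelope i') :
    Nonempty (E ≅ E') := by
  have := hM.1
  have := hM'.1
  have := hi.injective
  have := hi'.injective
  have := hi.mono
  have := hi'.mono
  obtain ⟨N, k, k', _, _, hN⟩ := hM.exists_common_sub hM'
    (support_le_loewyClass henough M _ (hs ▸ support_self M'))
    (support_le_loewyClass henough M' _ (hs ▸ support_self M))
  exact (isEssentialMono_of_indecomposable
    (hM.indecomposable_of_isEssentialMono hi.isEssentialMono) (k ≫ i) hN).exists_iso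
    (isEssentialMono_of_indecomposable
      (hM'.indecomposable_of_isEssentialMono hi'.isEssentialMono) (k' ≫ i') hN)

/-- Prime modules with isomorphic injective envelopes have the same support, since they share a
non-zero submodule. -/
lemma support_eq_of_iso {M M' E E' : C} (hM : IsPrimeModule M) (hM' : IsPrimeModule M')
    {i : M ⟶ E} {i' : M' ⟶ E'} (hi : IsInjectiveEnvelope i) (hi' : IsInjectiveEnvelope i')
    (e : E' ≅ E) : support M = support M' := by
  have := hi.mono
  have := hi'.mono
  have h := hi.essential M' (i' ≫ e.hom) hM'.1
  rw [← hM.2 _ (pullback.fst i (i' ≫ e.hom)) h, hM'.2 _ (pullback.snd i (i' ≫ e.hom)) h]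

end PrimeModules

end NCSpace

/-! ### Prime subspaces and indecomposable injectives -/

theorem mainTheorem3 (C : Type u) [Category.{v} C] [Abelian C] [IsGrothendieckAbelian.{v} C]
    (hnoeth : NCSpace.IsLocallyNoetherian C)
    (hdcc : WellFoundedLT (NCSpace.ClosedSubspace C))
    (henough : NCSpace.HasEnoughClosedSubspaces C) :
    ∃ Φ : NCSpace.PrimeSubspace C ≃ NCSpace.IndecInjective C,
      ∀ Z : NCSpace.PrimeSubspace C,
        (∃ M : C, NCSpace.IsCritical M ∧ NCSpace.IsPrimeModule M ∧ NCSpace.support M = Z.1) ∧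
        ∀ M : C, NCSpace.IsCritical M → NCSpace.IsPrimeModule M → NCSpace.support M = Z.1 →
          (∃ (E : C) (i : M ⟶ E), NCSpace.IsInjectiveEnvelope i) ∧
          ∀ (E : C) (i : M ⟶ E), NCSpace.IsInjectiveEnvelope i →
            (Φ Z).1 = Quotient.mk (isIsomorphicSetoid C) E := by
  open NCSpace in
  have hcrit (Z : PrimeSubspace C) :
      ∃ M : C, IsCritical M ∧ IsPrimeModule M ∧ support M = Z.1 := by
    obtain ⟨M, _, hM, hZ⟩ := Z.2.exists_prime
    obtain ⟨N, _, _, hN, hN', hs⟩ := exists_isCritical_isPrimeModule_sub hM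
    exact ⟨N, hN, hN', hs.trans hZ⟩
  have henv (M : C) : ∃ (E : C) (i : M ⟶ E), IsInjectiveEnvelope i := by
    obtain ⟨E, i, _, hi⟩ := exists_isEssentialMono_injective M
    exact ⟨E, i, hi.isInjectiveEnvelope⟩
  choose M hMc hMp hMs using hcrit
  choose E i hi using henv
  let F (Z : PrimeSubspace C) : IndecInjective C :=
    ⟨Quotient.mk _ (E (M Z)), E (M Z), rfl, (hi _).injective,
      (hMc Z).indecomposable_of_isEssentialMono (hi _).isEssentialMono⟩
  have hF : Function.Bijective F := by
    constructor
    · intro Z Z' h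
      obtain ⟨e⟩ : Nonempty (E (M Z') ≅ E (M Z)) := Quotient.exact (congr_arg Subtype.val h).symm
      refine Subtype.ext ?_
      rw [← hMs Z, ← hMs Z', support_eq_of_iso (hMp Z) (hMp Z') (hi _) (hi _) e]
    · rintro ⟨_, I, rfl, hI, hI'⟩
      obtain ⟨P, j, _, _, hP⟩ := exists_isPrimeModule_sub hnoeth hdcc hI'.1
      obtain ⟨N, k, _, hN, hNp, -⟩ := exists_isCritical_isPrimeModule_sub hP
      have hj := (isEssentialMono_of_indecomposable hI' (k ≫ j) hN.2.1).isInjectiveEnvelope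
      let Z : PrimeSubspace C := ⟨support N, isClosedSubspace_support N,
        ⟨N, support_self N, hN.2.1⟩, N, hN.1, hNp, rfl⟩
      -- `I` is the injective envelope of the critical prime module `N`, so it comes from the support
      -- of `N`.
      exact ⟨Z, Subtype.ext (Quotient.sound
        (nonempty_iso_of_support_eq henough (hMc Z) hN (hMs Z) (hi _) hj))⟩
  exact ⟨Equiv.ofBijective F hF, fun Z => ⟨⟨M Z, hMc Z, hMp Z, hMs Z⟩, fun N hN _ hNs =>
    ⟨⟨E N, i N, hi N⟩, fun I j hj => Quotient.sound
      (nonempty_iso_of_support_eq henough (hMc Z) hN ((hMs Z).trans hNs.symm) (hi _) hj)⟩⟩⟩
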